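/- Let $G$ be a finite group, let $I$ and $\Lambda$ be finite sets, and let $P=(p_{\lambda i})$ be a $\Lambda\times I$ matrix with entries in $G\cup\{0\}$. Let $S=\mathcal M^0[G;I,\Lambda;P]$ be the Rees matrix semigroup $(I\times G\times\Lambda)\cup\{0\}$ with product $(i,g,\lambda)(j,h,\mu)=(i,g\,p_{\lambda j}h,\mu)$ if $p_{\lambda j}\neq 0$, and all other products equal to $0$; $P$ is not assumed to be regular. The graph of a matrix with rows $\Lambda$ and columns $I$ is the bipartite graph on $I\sqcup\Lambda$ in which $i$ and $\lambda$ are adjacent if and only if the entry at $(\lambda,i)$ is non-zero. Suppose that $P$ is in Graham normal form $$P=\begin{pmatrix}C_R&0\\0&C_N\end{pmatrix},\qquad C_R=\begin{pmatrix}C_1&&\\&\ddots&\\&&C_n\end{pmatrix},$$ that is: $C_N$ is the zero matrix on $\Lambda'\times I'$, where $I'\subseteq I$ and $\Lambda'\subseteq\Lambda$; the sets $I\setminus I'$ and $\Lambda\setminus\Lambda'$ are partitioned as $I_1\cup\dots\cup I_n$ and $\Lambda_1\cup\dots\cup\Lambda_n$; all entries of $P$ outside of the blocks $\Lambda_k\times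 I_k$ are $0$; each block $C_k:\Lambda_k\times I_k\to G\cup\{0\}$ is regular (every row and every column has a non-zero entry) and has a connected graph; and there is a spanning forest of the graph of $P$ such that $p_{\lambda i}=1_G$ for each of its edges $\{i,\lambda\}$. The rank of $S$, written $\operatorname{rank}(S)$, is the least cardinality of a set $A\subseteq S$ such that every non-zero element of $S$ is a product of elements of $A$ (the element $0$ is always included in a generated subsemigroup). For a subset $A\subseteq G$ let $\operatorname{rank}(G:A)=\min\{|X|: X\subseteq G,\ \langle A\cup X\rangle=G\}$. Let $H_k$ be the subgroup of $G$ generated by the non-zero entries of $C_k$, and put $$\sigma_{\min}=\min\Big\{\operatorname{rank}\Big(G:\bigcup_{k=1}^n g_kH_kg_k^{-1}\Big)\;:\;g_1,\dots,g_n\in G\Big\}.$$ If $P$ is a zero matrix, then $\operatorname{rank}(S)=|G||I||\Lambda|$. Otherwise $$\operatorname{rank}(S)=\max\big(|I\setminus I'|,\ |\Lambda\setminus\Lambda'|,\ \sigma_{\min}+n-1\big)+|I'|+|\Lambda'|.$$ -/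

import Mathlib

/-- The underlying set `(I × G × Λ) ∪ {0}` of the Rees matrix semigroup `M⁰[G; I, Λ; P]` over the
group `G`, with structure matrix `P : Λ × I → G ∪ {0}`. -/
inductive ReesMatrixSemigroup {G I Λ : Type*} (P : Matrix Λ I (WithZero G)) where
  | zero : ReesMatrixSemigroup P
  | elem (i : I) (g : G) (l : Λ) : ReesMatrixSemigroup P

namespace ReesMatrixSemigroup

variable {G I Λ : Type*} [Group G] {P : Matrix Λ I (WithZero G)}

/-- `(i, g, l) (j, h, m) = (i, g p h, m)` if the entry `P l j` is `p ∈ G`, and `0` if it is `0`;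
products with `0` are `0`. -/
def mul : ReesMatrixSemigroup P → ReesMatrixSemigroup P → ReesMatrixSemigroup P
  | elem i g l, elem j h m => WithZero.recZeroCoe zero (fun p : G => elem i (g * p * h) m) (P l j)
  | zero, _ => zero
  | elem _ _ _, zero => zero

instance : SemigroupWithZero (ReesMatrixSemigroup P) where
  mul := mul
  zero := zero
  zero_mul := fun _ => rfl
  mul_zero := fun a => by cases a <;> rfl
  mul_assoc := fun a b c => by
    change mul (mul a b) c = mul a (mul b c)
    rcases a with _ | ⟨i, g, l⟩
    · rfl
    rcases b with _ | ⟨j, h, m⟩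
    · rfl
    rcases c with _ | ⟨k, x, r⟩
    · simp only [mul]
      induction P l j using WithZero.recZeroCoe <;> rfl
    · simp only [mul]
      induction hp : P l j using WithZero.recZeroCoe <;>
        induction hq : P m k using WithZero.recZeroCoe <;>
        simp [hp, hq, mul_assoc]

end ReesMatrixSemigroup

/-- The relative rank of a semigroup `S` modulo `A`: the least number of elements that have to be
added to `A` in order to generate `S` as a semigroup. -/
noncomputable def relativeRank (S : Type*) [Semigroup S] (A : Set S) : ℕ :=
  sInf {m : ℕ | ∃ X : Finset S, X.card = m ∧ Subsemigroup.closure (A ∪ (X : Set S)) = ⊤}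

/-- The rank of a semigroup with zero: the least number of elements whose products, together with
`0` (which is always included in a generated subsemigroup), exhaust `S`. -/
noncomputable def rankWithZero (S : Type*) [SemigroupWithZero S] : ℕ :=
  sInf {m : ℕ | ∃ A : Finset S, A.card = m ∧
    (Subsemigroup.closure (A : Set S) : Set S) ∪ {0} = Set.univ}

section

variable {G I Λ : Type*}

/-- The Graham–Houghton graph of `P`: the bipartite graph on `I ⊔ Λ` in which `i ∈ I` and `l ∈ Λ`
are adjacent iff `P l i ≠ 0`. -/
def grahamHoughtonGraph (P : Matrix Λ I (WithZero G)) : SimpleGraph (I ⊕ Λ) where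
  Adj
    | .inl i, .inr l => P l i ≠ 0
    | .inr l, .inl i => P l i ≠ 0
    | _, _ => False
  symm := ⟨by rintro (i | l) (j | m) h <;> exact h⟩
  loopless := ⟨by rintro (i | l) h <;> exact h⟩

/-- A matrix is regular if every row and every column has a non-zero entry. -/
def IsRegularMatrix (P : Matrix Λ I (WithZero G)) : Prop :=
  (∀ l, ∃ i, P l i ≠ 0) ∧ ∀ i, ∃ l, P l i ≠ 0

/-- `F` is a spanning forest of `Γ`: an acyclic subgraph with the same connected components. -/
def IsSpanningForest {V : Type*} (F Γ : SimpleGraph V) : Prop :=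
  F ≤ Γ ∧ F.IsAcyclic ∧ ∀ u v, Γ.Reachable u v → F.Reachable u v

/-- The submatrix of `P` with rows in `L` and columns in `J`. -/
def matrixBlock (P : Matrix Λ I (WithZero G)) (L : Set Λ) (J : Set I) :
    Matrix L J (WithZero G) :=
  P.submatrix Subtype.val Subtype.val

/-- `P` is in Graham normal form with zero block on `Λ' × I'` and diagonal blocks
`C_k` on `Λb k × Ib k`, `k = 1, …, n`. -/
structure IsGrahamNormalForm [Group G] (P : Matrix Λ I (WithZero G)) (I' : Set I) (Λ' : Set Λ)
    {n : ℕ} (Ib : Fin n → Set I) (Λb : Fin n → Set Λ) : Prop where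
  /-- The sets `Ib k` partition `I ∖ I'`. -/
  disjoint_cols : Pairwise fun j k => Disjoint (Ib j) (Ib k)
  iUnion_cols : (⋃ k, Ib k) = I'ᶜ
  /-- The sets `Λb k` partition `Λ ∖ Λ'`. -/
  disjoint_rows : Pairwise fun j k => Disjoint (Λb j) (Λb k)
  iUnion_rows : (⋃ k, Λb k) = Λ'ᶜ
  /-- All entries outside of the diagonal blocks are zero. -/
  zero_off_blocks : ∀ l i, (¬ ∃ k, l ∈ Λb k ∧ i ∈ Ib k) → P l i = 0
  /-- The diagonal blocks are regular and connected. -/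
  regular_block : ∀ k, IsRegularMatrix (matrixBlock P (Λb k) (Ib k))
  connected_block : ∀ k, (grahamHoughtonGraph (matrixBlock P (Λb k) (Ib k))).Connected
  /-- `P` is normalized: its entries along the edges of some spanning forest are `1`. -/
  normalized : ∃ F : SimpleGraph (I ⊕ Λ), IsSpanningForest F (grahamHoughtonGraph P) ∧
    ∀ i l, F.Adj (.inl i) (.inr l) → P l i = ((1 : G) : WithZero G)

/-- The subgroup of `G` generated by the non-zero entries of a matrix over `G ∪ {0}`. -/
def entrySubgroup [Group G] (C : Matrix Λ I (WithZero G)) : Subgroup G :=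
  Subgroup.closure {g : G | ∃ l i, C l i = (g : WithZero G)}

/-- `σ_min`: the minimum over `g₁, …, gₙ ∈ G` of the relative rank of `G` modulo
`⋃ k, g_k H_k g_k⁻¹`. -/
noncomputable def sigmaMin [Group G] {n : ℕ} (H : Fin n → Subgroup G) : ℕ :=
  sInf (Set.range fun g : Fin n → G =>
    relativeRank G (⋃ k, (fun h => g k * h * (g k)⁻¹) '' (H k : Set G)))

end

/-!
Draw an arrow `l → i` with label `P l i` for every non-zero entry of `P`, and an arrow `i → l` with
label `g` for every generator `(i, g, l)`. The non-zero products of generators are then the walks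
from `I` to `Λ` in this gain graph on `I ⊔ Λ`, with the product of the labels as group component.

A column in `I'` or a row in `Λ'` only occurs at an end of a non-zero product, so each of them
requires a generator of its own, and one for each of them suffices. This leaves the regular core.

Lower bound for the core: some generator starts in each column and some generator ends in each row.
Moreover, generators must lead from any set of blocks to its complement, so `n - 1` of them form a
spanning tree on the blocks. A potential on the blocks turns the labels of this tree into `1` and
`H_k` into a conjugate; the labels of the other generators have to generate `G` together with these
conjugates.

Upper bound: permuting the rows of the generators makes the gain graph strongly connected, since an
exchange of rows merges two cycles. The labels of the generators outside of a spanning tree on the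
blocks can then be used to realize `σ_min`. As `G` is finite, walks can be inverted, and so every
element of `G` is the label of a walk between any two vertices.
-/

section StrongConnectivity

open Relation

variable {α : Type*}

theorem exists_transGen_self_of_serial [Finite α] {r : α → α → Prop} (hr : ∀ a, ∃ b, r a b)
    (a : α) : ∃ c, TransGen r a c ∧ TransGen r c c := by
  obtain ⟨d, had⟩ := hr a
  obtain ⟨c, hac, hmin⟩ := (Set.toFinite {c | TransGen r a c}).exists_minimalFor
    (fun c => {d | TransGen r c d}) _ ⟨d, .single had⟩
  obtain ⟨e, hce⟩ := hr c
  have hreach : {d | TransGen r c d} ⊆ {d | TransGen r e d} :=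
    hmin (hac.tail hce) fun _ h => h.head hce
  exact ⟨e, hac.tail hce, hreach (.single hce)⟩

theorem reflTransGen_of_forall_step {r r' : α → α → Prop} {x z : α} (h : ReflTransGen r x z)
    (hstep : ∀ c d, ReflTransGen r x c → c ≠ z → r c d → ReflTransGen r d z → r' c d) :
    ReflTransGen r' x z := by
  induction h using ReflTransGen.head_induction_on with
  | refl => exact .refl
  | @head c d hcd hdz ih =>
    rcases eq_or_ne c z with rfl | hcz
    · exact .refl
    · exact .head (hstep c d .refl hcz hcd hdz) (ih fun e f hde => hstep e f (.head hcd hde))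

section ExchangeOut

variable [DecidableEq α] {r : α → α → Prop} {a b : α}

/-- The relation `r` with the out-neighbourhoods of `a` and `b` exchanged. An exchange at
vertices of two disjoint cycles merges these cycles into one. -/
def exchangeOut (r : α → α → Prop) (a b : α) : α → α → Prop :=
  fun x y => r (Equiv.swap a b x) y

theorem exchangeOut_left {y : α} : exchangeOut r a b a y ↔ r b y := by simp [exchangeOut]

theorem exchangeOut_right {y : α} : exchangeOut r a b b y ↔ r a y := by simp [exchangeOut]

theorem exchangeOut_of_ne {x y : α} (ha : x ≠ a) (hb : x ≠ b) :
    exchangeOut r a b x y ↔ r x y := by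
  rw [exchangeOut, Equiv.swap_apply_of_ne_of_ne ha hb]

theorem transGen_exchangeOut_left (hb : TransGen r b b) (hab : ¬ TransGen r a b) :
    TransGen (exchangeOut r a b) a b := by
  obtain ⟨c, hbc, hcb⟩ := TransGen.head'_iff.1 hb
  refine .head' (exchangeOut_left.2 hbc) (reflTransGen_of_forall_step hcb ?_)
  rintro d e - hdb hde heb
  refine (exchangeOut_of_ne ?_ hdb).2 hde
  rintro rfl
  exact hab (.head' hde heb)

theorem transGen_exchangeOut_right (ha : TransGen r a a) (hab : ¬ TransGen r a b) :
    TransGen (exchangeOut r a b) b a := by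
  obtain ⟨c, hac, hca⟩ := TransGen.head'_iff.1 ha
  refine .head' (exchangeOut_right.2 hac) (reflTransGen_of_forall_step hca ?_)
  rintro d e hcd hda hde -
  refine (exchangeOut_of_ne hda ?_).2 hde
  rintro rfl
  exact hab (.head' hac hcd)

theorem transGen_exchangeOut_of_transGen (ha : TransGen r a a) (hb : TransGen r b b)
    (hab : ¬ TransGen r a b) {u v : α} (h : TransGen r u v) :
    TransGen (exchangeOut r a b) u v := by
  refine TransGen.closed (fun x y hxy => ?_) _ _ h
  rcases eq_or_ne x a with rfl | hxa
  · exact (transGen_exchangeOut_left hb hab).tail (exchangeOut_right.2 hxy)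
  rcases eq_or_ne x b with rfl | hxb
  · exact (transGen_exchangeOut_right ha hab).tail (exchangeOut_left.2 hxy)
  exact .single ((exchangeOut_of_ne hxa hxb).2 hxy)

end ExchangeOut

theorem exists_perm_transGen [Finite α] {r : α → α → Prop} (hout : ∀ a, ∃ b, r a b)
    (hin : ∀ b, ∃ a, r a b) :
    ∃ π : Equiv.Perm α, ∀ a b, TransGen (fun x y => r (π x) y) a b := by
  classical
  let reach (π : Equiv.Perm α) : Set (α × α) := {p | TransGen (fun x y => r (π x) y) p.1 p.2}
  obtain ⟨π, hπ⟩ := Finite.exists_max fun π => (reach π).ncard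
  -- Two cycles, the first of which does not lead to the second, could be merged by an exchange.
  have hcycles : ∀ a b, (a, a) ∈ reach π → (b, b) ∈ reach π → (a, b) ∈ reach π := by
    intro a b ha hb
    by_contra hab
    have hssub : reach π ⊂ reach (π * Equiv.swap a b) :=
      ⟨fun _ h => transGen_exchangeOut_of_transGen ha hb hab h,
        fun h => hab (h (show (a, b) ∈ _ from transGen_exchangeOut_left hb hab))⟩
    exact (Set.ncard_lt_ncard hssub).not_ge (hπ _)
  refine ⟨π, fun a b => ?_⟩
  obtain ⟨c, hac, hcc⟩ := exists_transGen_self_of_serial (fun x => hout (π x)) a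
  have hin' (y : α) : ∃ x, Function.swap (fun x y => r (π x) y) y x :=
    (hin y).imp' π.symm fun x hx => by simpa [Function.swap] using hx
  obtain ⟨d, hdb, hdd⟩ := exists_transGen_self_of_serial hin' b
  rw [transGen_swap] at hdb hdd
  exact (hac.trans (hcycles c d hcc hdd)).trans hdb

end StrongConnectivity

section OutTree

open Relation

variable {α κ : Type*}

/-- `IsOutTree s t T V`: the arrows `s a → t a`, `a ∈ T`, form a directed tree with vertex set `V`
in which every arrow points away from the root. Such a tree is grown from its root, one arrow out
of the current vertex set at a time. -/
inductive IsOutTree (s t : α → κ) : Set α → Set κ → Prop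
  | root (k : κ) : IsOutTree s t ∅ {k}
  | grow {T : Set α} {V : Set κ} {a : α} (h : IsOutTree s t T V) (hs : s a ∈ V) (ht : t a ∉ V) :
    IsOutTree s t (insert a T) (insert (t a) V)

theorem exists_isOutTree_univ [Finite κ] [Nonempty κ] {s t : α → κ}
    (hleave : ∀ V : Set κ, V.Nonempty → V ≠ Set.univ → ∃ a, s a ∈ V ∧ t a ∉ V) :
    ∃ T, IsOutTree s t T Set.univ := by
  obtain ⟨k⟩ := ‹Nonempty κ›
  obtain ⟨V, ⟨⟨T, hT⟩, hV⟩, hmax⟩ :=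
    (Set.toFinite {V : Set κ | (∃ T, IsOutTree s t T V) ∧ V.Nonempty}).exists_maximal
      ⟨{k}, ⟨∅, .root k⟩, Set.singleton_nonempty k⟩
  obtain rfl : V = Set.univ := by
    by_contra hne
    obtain ⟨a, hs, ht⟩ := hleave V hV hne
    exact ht (hmax ⟨⟨_, hT.grow hs ht⟩, Set.insert_nonempty _ _⟩ (Set.subset_insert _ _)
      (Set.mem_insert _ _))
  exact ⟨T, hT⟩

namespace IsOutTree

variable {s t : α → κ} {T : Set α} {V : Set κ}

theorem mem_of_mem (h : IsOutTree s t T V) {a : α} (ha : a ∈ T) : s a ∈ V ∧ t a ∈ V := by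
  induction h with
  | root => exact ha.elim
  | grow _ hs _ ih =>
    rcases ha with rfl | ha
    · exact ⟨.inr hs, .inl rfl⟩
    · exact (ih ha).imp .inr .inr

theorem ncard_add_one [Finite α] [Finite κ] (h : IsOutTree s t T V) : T.ncard + 1 = V.ncard := by
  induction h with
  | root => simp
  | grow h _ ht ih =>
    rw [Set.ncard_insert_of_notMem fun ha => ht (h.mem_of_mem ha).2,
      Set.ncard_insert_of_notMem ht, ih]

theorem exists_potential {G : Type*} [Group G] (h : IsOutTree s t T V) (x : α → G) :
    ∃ θ : κ → G, ∀ a ∈ T, θ (s a) * x a * (θ (t a))⁻¹ = 1 := by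
  classical
  induction h with
  | root => exact ⟨1, fun _ ha => ha.elim⟩
  | @grow T V a h hs ht ih =>
    obtain ⟨θ, hθ⟩ := ih
    refine ⟨Function.update θ (t a) (θ (s a) * x a), fun c hc => ?_⟩
    have hne {k : κ} (hk : k ∈ V) : k ≠ t a := fun e => ht (e ▸ hk)
    rcases hc with rfl | hc
    · simp [Function.update_of_ne (hne hs)]
    · obtain ⟨hsc, htc⟩ := h.mem_of_mem hc
      rw [Function.update_of_ne (hne hsc), Function.update_of_ne (hne htc), hθ c hc]

theorem eqvGen (h : IsOutTree s t T V) {u v : κ} (hu : u ∈ V) (hv : v ∈ V) :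
    EqvGen (fun k k' => ∃ a ∈ T, s a = k ∧ t a = k') u v := by
  induction h generalizing u v with
  | root =>
    obtain rfl := hu
    obtain rfl := hv
    exact .refl _
  | @grow T V a _ hs _ ih =>
    have hsource : ∀ w ∈ insert (t a) V,
        EqvGen (fun k k' => ∃ c ∈ insert a T, s c = k ∧ t c = k') (s a) w := by
      rintro w (rfl | hw)
      · exact .rel _ _ ⟨a, Set.mem_insert a T, rfl, rfl⟩
      · exact (ih hs hw).mono fun _ _ ⟨c, hc, hk⟩ => ⟨c, Set.mem_insert_of_mem a hc, hk⟩
    exact (hsource u hu).symm.trans _ _ _ (hsource v hv)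

end IsOutTree

end OutTree

theorem exists_eqOn_and_subset_range {α β : Type*} [Finite α] {T : Set α} {X : Set β}
    (hX : X.Finite) (h : X.ncard ≤ Tᶜ.ncard) (b : β) :
    ∃ y : α → β, (∀ a ∈ T, y a = b) ∧ X ⊆ Set.range y := by
  have := hX.to_subtype
  obtain ⟨e⟩ : Nonempty (X ↪ ↥Tᶜ) := by
    have := Fintype.ofFinite X
    have := Fintype.ofFinite ↥Tᶜ
    apply Function.Embedding.nonempty_of_card_le
    rwa [← Nat.card_eq_fintype_card, ← Nat.card_eq_fintype_card]
  let e' : X ↪ α := e.trans (.subtype _)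
  refine ⟨Function.extend e' Subtype.val fun _ => b, fun a ha => ?_, fun x hx => ?_⟩
  · refine Function.extend_apply' _ _ _ ?_
    rintro ⟨x, rfl⟩
    exact (e x).2 ha
  · exact ⟨e' ⟨x, hx⟩, e'.injective.extend_apply _ _ _⟩

theorem exists_surjective_of_card_le {α β : Type*} [Finite α] [Finite β] [Nonempty β]
    (h : Nat.card β ≤ Nat.card α) : ∃ f : α → β, Function.Surjective f := by
  obtain ⟨f, -, hf⟩ := exists_eqOn_and_subset_range (T := (∅ : Set α)) (Set.finite_univ (α := β))
    (by simpa using h) (Classical.arbitrary β)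
  exact ⟨f, fun y => hf (Set.mem_univ y)⟩

theorem exists_surjective_transGen {α β γ : Type*} [Finite α] [Finite β] [Finite γ] [Nonempty β]
    [Nonempty γ] {r : β → γ → Prop} (hleft : ∀ b, ∃ c, r b c) (hright : ∀ c, ∃ b, r b c)
    (hβ : Nat.card β ≤ Nat.card α) (hγ : Nat.card γ ≤ Nat.card α) :
    ∃ (f : α → β) (g : α → γ), Function.Surjective f ∧ Function.Surjective g ∧
      ∀ x y, Relation.TransGen (fun x y => r (f x) (g y)) x y := by
  obtain ⟨f, hf⟩ := exists_surjective_of_card_le hβ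
  obtain ⟨g, hg⟩ := exists_surjective_of_card_le hγ
  obtain ⟨π, hπ⟩ := exists_perm_transGen (r := fun x y => r (f x) (g y))
    (fun x => let ⟨c, hc⟩ := hleft (f x); let ⟨y, hy⟩ := hg c; ⟨y, hy ▸ hc⟩)
    (fun y => let ⟨b, hb⟩ := hright (g y); let ⟨x, hx⟩ := hf b; ⟨x, hx ▸ hb⟩)
  exact ⟨f ∘ π, g, hf.comp π.surjective, hg, hπ⟩

theorem exists_forall_mem_iff_eq {γ κ : Type*} {J : Set γ} {B : κ → Set γ}
    (hdisj : Pairwise fun j k => Disjoint (B j) (B k)) (hunion : ⋃ k, B k = J) :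
    ∃ c : J → κ, ∀ j k, ↑j ∈ B k ↔ c j = k := by
  have hmem (j : J) : ∃ k, ↑j ∈ B k := Set.mem_iUnion.1 (hunion ▸ j.2)
  choose c hc using hmem
  refine ⟨c, fun j k => ⟨fun hk => ?_, fun h => h ▸ hc j⟩⟩
  by_contra hne
  exact Set.disjoint_left.1 (hdisj hne) (hc j) hk

section LabelledWalk

/-- `LabelledWalk E u g v`: in the directed graph `E` whose arrows are labelled by elements of `G`
(a gain graph), some walk from `u` to `v` has labels with product `g`. -/
inductive LabelledWalk {V G : Type*} [Monoid G] (E : V → G → V → Prop) (u : V) : G → V → Prop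
  | refl : LabelledWalk E u 1 u
  | tail {g x : G} {v w : V} (h : LabelledWalk E u g v) (e : E v x w) : LabelledWalk E u (g * x) w

/-- The labels that occur on the arrows of `E`. -/
def arrowLabels {V G : Type*} (E : V → G → V → Prop) : Set G :=
  {x | ∃ u v, E u x v}

/-- The relabelling of `E` by a potential `ψ` on its vertices (switching of a gain graph): an arrow
`u → v` with label `x` gets the label `ψ u * x * (ψ v)⁻¹`. -/
def switch {V G : Type*} [Group G] (ψ : V → G) (E : V → G → V → Prop) : V → G → V → Prop :=
  fun u x v => E u ((ψ u)⁻¹ * x * ψ v) v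

theorem switch_of_arrow {V G : Type*} [Group G] {E : V → G → V → Prop} {u v : V} {x : G}
    (ψ : V → G) (e : E u x v) : switch ψ E u (ψ u * x * (ψ v)⁻¹) v := by
  simpa [switch, mul_assoc] using e

theorem arrowLabels_switch {V G : Type*} [Group G] (ψ : V → G) (E : V → G → V → Prop) :
    arrowLabels (switch ψ E) = {z | ∃ u x v, E u x v ∧ ψ u * x * (ψ v)⁻¹ = z} := by
  ext z
  constructor
  · rintro ⟨u, v, e⟩
    exact ⟨u, _, v, e, by group⟩
  · rintro ⟨u, x, v, e, rfl⟩
    exact ⟨u, v, switch_of_arrow ψ e⟩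

namespace LabelledWalk

variable {V G : Type*}

section Monoid

variable [Monoid G] {E : V → G → V → Prop} {u v w : V} {g h x : G}

theorem single (e : E u x v) : LabelledWalk E u x v := by
  simpa using refl.tail e

theorem trans (p : LabelledWalk E u g v) (q : LabelledWalk E v h w) :
    LabelledWalk E u (g * h) w := by
  induction q with
  | refl => rwa [mul_one]
  | tail _ e ih => simpa [mul_assoc] using ih.tail e

theorem pow (p : LabelledWalk E u g u) (k : ℕ) : LabelledWalk E u (g ^ k) u := by
  induction k with
  | zero => simpa using refl
  | succ k ih => simpa [pow_succ] using ih.trans p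

theorem exists_arrow_leaving {W : Set V} (p : LabelledWalk E u g v) (hu : u ∈ W) (hv : v ∉ W) :
    ∃ a x b, E a x b ∧ a ∈ W ∧ b ∉ W := by
  induction p with
  | refl => exact (hv hu).elim
  | @tail _ x a b _ e ih =>
    by_cases ha : a ∈ W
    · exact ⟨a, x, b, e, ha, hv⟩
    · exact ih ha

end Monoid

variable [Group G] {E : V → G → V → Prop} {u v : V} {g h z : G}

theorem mem_closure (p : LabelledWalk E u g v) : g ∈ Subgroup.closure (arrowLabels E) := by
  induction p with
  | refl => exact one_mem _
  | tail _ e ih => exact mul_mem ih (Subgroup.subset_closure ⟨_, _, e⟩)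

theorem inv [Finite G] (p : LabelledWalk E u g v) (q : LabelledWalk E v h u) :
    LabelledWalk E v g⁻¹ u := by
  obtain ⟨k, hk⟩ : (h * g)⁻¹ ∈ Submonoid.powers (h * g) :=
    mem_powers_iff_mem_zpowers.2 (inv_mem (Subgroup.mem_zpowers _))
  simpa [hk] using ((q.trans p).pow k).trans q

theorem of_mem_closure [Finite G] (hconn : ∀ u v, ∃ g, LabelledWalk E u g v)
    (hone : ∀ u v, Relation.EqvGen (fun u v => E u 1 v) u v)
    (hz : z ∈ Subgroup.closure (arrowLabels E)) (u v : V) : LabelledWalk E u z v := by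
  have walk_inv {u v : V} {g : G} (p : LabelledWalk E u g v) : LabelledWalk E v g⁻¹ u :=
    p.inv (hconn v u).choose_spec
  have walk_one (u v : V) : LabelledWalk E u 1 v := by
    induction hone u v with
    | rel u v e => exact single e
    | refl u => exact refl
    | symm u v _ ih => simpa using walk_inv ih
    | trans u v w _ _ ih ih' => simpa using ih.trans ih'
  let K : Subgroup G :=
    { carrier := {z | ∀ u v, LabelledWalk E u z v}
      one_mem' := walk_one
      mul_mem' := fun hx hy u v => (hx u u).trans (hy u v)
      inv_mem' := fun hx u v => walk_inv (hx v u) }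
  have hK : arrowLabels E ⊆ K := by
    rintro x ⟨a, b, e⟩ u v
    simpa using ((walk_one u a).tail e).trans (walk_one b v)
  exact (Subgroup.closure_le K).2 hK hz u v

theorem switch_iff (ψ : V → G) :
    LabelledWalk (switch ψ E) u z v ↔ LabelledWalk E u ((ψ u)⁻¹ * z * ψ v) v := by
  constructor
  · intro p
    induction p with
    | refl => simpa using refl
    | tail _ e ih => simpa [mul_assoc] using ih.tail e
  · suffices h : ∀ {y}, LabelledWalk E u y v → LabelledWalk (switch ψ E) u (ψ u * y * (ψ v)⁻¹) v by
      exact fun p => by simpa [mul_assoc] using h p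
    intro y p
    induction p with
    | refl => simpa using refl
    | tail _ e ih => simpa [mul_assoc] using ih.tail (switch_of_arrow ψ e)

end LabelledWalk

end LabelledWalk

section SigmaMin

variable {G κ : Type*} [Group G]

theorem subsemigroup_closure_eq_top_iff [Finite G] {A : Set G} (hA : 1 ∈ A) :
    Subsemigroup.closure A = ⊤ ↔ Subgroup.closure A = ⊤ := by
  have hset : (Subgroup.closure A : Set G) = Subsemigroup.closure A := by
    rw [← Subgroup.coe_toSubmonoid, Subgroup.closure_toSubmonoid_of_finite,
      Submonoid.closure_eq_one_union, Set.union_eq_right, Set.singleton_subset_iff]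
    exact Subsemigroup.subset_closure hA
  simp only [SetLike.ext'_iff, hset, Subsemigroup.coe_top, Subgroup.coe_top]

/-- The union of the conjugates `θ k * H k * (θ k)⁻¹`, as in the definition of `sigmaMin`. -/
def conjUnion (θ : κ → G) (H : κ → Subgroup G) : Set G :=
  ⋃ k, (fun h => θ k * h * (θ k)⁻¹) '' (H k : Set G)

theorem one_mem_conjUnion [Nonempty κ] (θ : κ → G) (H : κ → Subgroup G) : 1 ∈ conjUnion θ H :=
  Set.mem_iUnion.2 ⟨Classical.arbitrary κ, 1, one_mem _, by simp⟩

variable [Finite G] {n : ℕ} [NeZero n] {H : Fin n → Subgroup G}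

theorem sigmaMin_le_ncard {θ : Fin n → G} {X : Set G}
    (h : Subgroup.closure (conjUnion θ H ∪ X) = ⊤) : sigmaMin H ≤ X.ncard := by
  have hX := X.toFinite
  have hrank : relativeRank G (conjUnion θ H) ≤ X.ncard := by
    refine Nat.sInf_le ⟨hX.toFinset, (Set.ncard_eq_toFinset_card X hX).symm, ?_⟩
    rwa [hX.coe_toFinset, subsemigroup_closure_eq_top_iff (.inl (one_mem_conjUnion θ H))]
  exact le_trans (Nat.sInf_le ⟨θ, rfl⟩) hrank

variable (H) in
theorem exists_ncard_eq_sigmaMin : ∃ (θ : Fin n → G) (X : Set G),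
    X.ncard = sigmaMin H ∧ Subgroup.closure (conjUnion θ H ∪ X) = ⊤ := by
  have := Fintype.ofFinite G
  obtain ⟨θ, hθ⟩ : ∃ θ, relativeRank G (conjUnion θ H) = sigmaMin H :=
    Nat.sInf_mem (Set.range_nonempty _)
  obtain ⟨X, hX, hclosure⟩ : relativeRank G (conjUnion θ H) ∈ _ :=
    Nat.sInf_mem ⟨_, Finset.univ, rfl, by simp⟩
  refine ⟨θ, X, by rw [Set.ncard_coe_finset, hX, hθ], ?_⟩
  rwa [subsemigroup_closure_eq_top_iff (.inl (one_mem_conjUnion θ H))] at hclosure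

end SigmaMin

namespace ReesMatrixSemigroup

section Generation

variable {G I Λ α : Type*}

/-- The triple `(i, g, l)` as a non-zero element of `M⁰[G; I, Λ; P]`. -/
def ofTriple (P : Matrix Λ I (WithZero G)) (t : I × G × Λ) : ReesMatrixSemigroup P :=
  elem t.1 t.2.1 t.2.2

instance {P : Matrix Λ I (WithZero G)} [Finite G] [Finite I] [Finite Λ] :
    Finite (ReesMatrixSemigroup P) :=
  .of_surjective (fun t : Option (I × G × Λ) => t.elim zero (ofTriple P)) fun
    | zero => ⟨none, rfl⟩
    | elem i g l => ⟨some (i, g, l), rfl⟩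

theorem ofTriple_injective {P : Matrix Λ I (WithZero G)} : Function.Injective (ofTriple P) := by
  rintro ⟨i, g, l⟩ ⟨j, h, m⟩ e
  cases e
  rfl

variable [Group G]

/-- `IsProduct P w i g l`: the triple `(i, g, l)` is a product of members of the family `w` of
non-zero elements of `M⁰[G; I, Λ; P]`. -/
inductive IsProduct (P : Matrix Λ I (WithZero G)) (w : α → I × G × Λ) : I → G → Λ → Prop
  | gen (a : α) : IsProduct P w (w a).1 (w a).2.1 (w a).2.2
  | mul {i j : I} {l m : Λ} {g h x : G} (hx : P l j = x) (hl : IsProduct P w i g l)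
    (hr : IsProduct P w j h m) : IsProduct P w i (g * x * h) m

/-- The family `w` of non-zero elements generates all non-zero elements of `M⁰[G; I, Λ; P]`. -/
def IsGeneratingFamily (P : Matrix Λ I (WithZero G)) (w : α → I × G × Λ) : Prop :=
  ∀ i g l, IsProduct P w i g l

variable {P : Matrix Λ I (WithZero G)} {w : α → I × G × Λ} {i j : I} {g : G} {l m : Λ}

theorem elem_mul_elem {h x : G} (hx : P l j = x) :
    (elem i g l : ReesMatrixSemigroup P) * elem j h m = elem i (g * x * h) m := by
  change mul _ _ = _
  simp only [mul, hx, WithZero.recZeroCoe_coe]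

theorem elem_mul_elem_of_eq_zero {h : G} (hlj : P l j = 0) :
    (elem i g l : ReesMatrixSemigroup P) * elem j h m = 0 := by
  change mul _ _ = _
  simp only [mul, hlj, WithZero.recZeroCoe_zero]
  rfl

theorem elem_ne_zero : (elem i g l : ReesMatrixSemigroup P) ≠ 0 :=
  fun h => nomatch (show elem i g l = zero from h)

theorem IsProduct.of_eq {a : α} (h : w a = (i, g, l)) : IsProduct P w i g l := by
  simpa only [h] using IsProduct.gen (P := P) (w := w) a

theorem IsProduct.elem_mem_closure (h : IsProduct P w i g l) :
    elem i g l ∈ Subsemigroup.closure (Set.range (ofTriple P ∘ w)) := by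
  induction h with
  | gen a => exact Subsemigroup.subset_closure ⟨a, rfl⟩
  | mul hx _ _ ihl ihr => exact elem_mul_elem hx ▸ mul_mem ihl ihr

theorem isProduct_of_mem_closure {A : Set (ReesMatrixSemigroup P)}
    (h : elem i g l ∈ Subsemigroup.closure A) :
    IsProduct P (fun t : ofTriple P ⁻¹' A => t.1) i g l := by
  generalize hs : elem i g l = s at h
  induction h using Subsemigroup.closure_induction generalizing i g l with
  | mem s hsA =>
    subst hs
    exact .of_eq (a := ⟨(i, g, l), hsA⟩) rfl
  | mul s t _ _ ihs iht =>
    have hst : s * t ≠ 0 := hs ▸ elem_ne_zero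
    rcases s with _ | ⟨i, g, l⟩
    · exact (hst (zero_mul t)).elim
    rcases t with _ | ⟨j, h, m⟩
    · exact (hst (mul_zero _)).elim
    cases hx : P l j with
    | zero => exact (hst (elem_mul_elem_of_eq_zero hx)).elim
    | coe x =>
      rw [elem_mul_elem hx] at hs
      cases hs
      exact .mul hx (ihs rfl) (iht rfl)

theorem rankWithZero_le [Finite α] (hw : IsGeneratingFamily P w) :
    rankWithZero (ReesMatrixSemigroup P) ≤ Nat.card α := by
  have hfin := Set.finite_range (ofTriple P ∘ w)
  have hcard : hfin.toFinset.card ≤ Nat.card α := by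
    rw [← Set.ncard_eq_toFinset_card _ hfin, ← Nat.card_coe_set_eq]
    exact Finite.card_range_le _
  refine le_trans (Nat.sInf_le ⟨hfin.toFinset, rfl, Set.eq_univ_of_forall fun s => ?_⟩) hcard
  rcases s with _ | ⟨i, g, l⟩
  · exact .inr rfl
  · exact .inl (by simpa using (hw i g l).elem_mem_closure)

variable (P) in
theorem exists_isGeneratingFamily [Finite G] [Finite I] [Finite Λ] :
    ∃ T : Set (I × G × Λ), IsGeneratingFamily P (fun t : T => t.1) ∧
      T.ncard ≤ rankWithZero (ReesMatrixSemigroup P) := by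
  have := Fintype.ofFinite (ReesMatrixSemigroup P)
  obtain ⟨A, hcard, hA⟩ : rankWithZero (ReesMatrixSemigroup P) ∈ _ :=
    Nat.sInf_mem ⟨_, Finset.univ, rfl, by simp⟩
  refine ⟨ofTriple P ⁻¹' A, fun i g l => isProduct_of_mem_closure ?_, ?_⟩
  · exact (hA.ge (Set.mem_univ (elem i g l))).resolve_right elem_ne_zero
  · rw [← hcard, ← Set.ncard_coe_finset]
    exact Set.ncard_le_ncard_of_injOn (ofTriple P) (fun _ => id) ofTriple_injective.injOn

theorem rankWithZero_of_eq_zero [Finite G] [Finite I] [Finite Λ] (hP : P = 0) :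
    rankWithZero (ReesMatrixSemigroup P) = Nat.card G * Nat.card I * Nat.card Λ := by
  have hcard : Nat.card (I × G × Λ) = Nat.card G * Nat.card I * Nat.card Λ := by
    simp only [Nat.card_prod]
    ring
  rw [← hcard]
  refine (rankWithZero_le fun i g l => .of_eq (w := id) rfl).antisymm ?_
  obtain ⟨T, hT, hle⟩ := exists_isGeneratingFamily P
  have hTuniv : T = Set.univ := by
    refine Set.eq_univ_of_forall fun ⟨i, g, l⟩ => ?_
    cases hT i g l with
    | gen a => exact a.2
    | mul hx => simp [hP] at hx
  rwa [hTuniv, Set.ncard_univ] at hle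

namespace IsGeneratingFamily

theorem exists_col_eq (hw : IsGeneratingFamily P w) (hlj : P l j ≠ 0) (i : I) :
    ∃ a, (w a).1 = i ∧ ∃ j, P (w a).2.2 j ≠ 0 := by
  suffices ∀ {g l}, IsProduct P w i g l → (∃ j, P l j ≠ 0) →
      ∃ a, (w a).1 = i ∧ ∃ j, P (w a).2.2 j ≠ 0 from this (hw i 1 l) ⟨j, hlj⟩
  intro g l h hl
  induction h with
  | gen a => exact ⟨a, rfl, hl⟩
  | mul hx _ _ ih _ => exact ih ⟨_, hx ▸ WithZero.coe_ne_zero⟩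

theorem exists_row_eq (hw : IsGeneratingFamily P w) (hlj : P l j ≠ 0) (m : Λ) :
    ∃ a, (w a).2.2 = m ∧ ∃ l, P l (w a).1 ≠ 0 := by
  suffices ∀ {j g}, IsProduct P w j g m → (∃ l, P l j ≠ 0) →
      ∃ a, (w a).2.2 = m ∧ ∃ l, P l (w a).1 ≠ 0 from this (hw j 1 m) ⟨l, hlj⟩
  intro j g h hj
  induction h with
  | gen a => exact ⟨a, rfl, hj⟩
  | mul hx _ _ _ ih => exact ih ⟨_, hx ▸ WithZero.coe_ne_zero⟩

end IsGeneratingFamily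

end Generation

section ZeroBlock

variable {G I Λ α : Type*} [Group G] {P : Matrix Λ I (WithZero G)} {I' : Set I} {Λ' : Set Λ}

theorem IsGeneratingFamily.card_core_add_le [Finite α] {w : α → I × G × Λ}
    (hw : IsGeneratingFamily P w) (hcore : ∀ l i, P l i ≠ 0 → l ∉ Λ' ∧ i ∉ I') {m : Λ} {j : I}
    (hmj : P m j ≠ 0) :
    {a | (w a).1 ∉ I' ∧ (w a).2.2 ∉ Λ'}.ncard + I'.ncard + Λ'.ncard ≤ Nat.card α := by
  have hI : I'.ncard ≤ {a | (w a).1 ∈ I' ∧ (w a).2.2 ∉ Λ'}.ncard := by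
    refine (Set.ncard_le_ncard fun i hi => ?_).trans (Set.ncard_image_le (f := fun a => (w a).1))
    obtain ⟨a, rfl, k, hak⟩ := hw.exists_col_eq hmj i
    exact ⟨a, ⟨hi, (hcore _ _ hak).1⟩, rfl⟩
  have hΛ : Λ'.ncard ≤ {a | (w a).1 ∉ I' ∧ (w a).2.2 ∈ Λ'}.ncard := by
    refine (Set.ncard_le_ncard fun l hl => ?_).trans (Set.ncard_image_le (f := fun a => (w a).2.2))
    obtain ⟨a, rfl, k, hak⟩ := hw.exists_row_eq hmj l
    exact ⟨a, ⟨(hcore _ _ hak).2, hl⟩, rfl⟩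
  refine (add_le_add (add_le_add_right hI _) hΛ).trans ?_
  rw [← Set.ncard_union_eq, ← Set.ncard_union_eq]
  · exact Set.ncard_le_card _
  · rw [Set.disjoint_left]
    rintro a (ha | ha) ha'
    · exact ha.2 ha'.2
    · exact ha'.1 ha.1
  · exact Set.disjoint_left.2 fun a ha ha' => ha.1 ha'.1

theorem IsGeneratingFamily.restrict {w : α → I × G × Λ} (hw : IsGeneratingFamily P w)
    (hcore : ∀ l i, P l i ≠ 0 → l ∉ Λ' ∧ i ∉ I') :
    IsGeneratingFamily (matrixBlock P Λ'ᶜ I'ᶜ)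
      fun a : {a // (w a).1 ∉ I' ∧ (w a).2.2 ∉ Λ'} =>
        (⟨(w a).1, a.2.1⟩, (w a).2.1, ⟨(w a).2.2, a.2.2⟩) := by
  rintro ⟨i, hi⟩ g ⟨l, hl⟩
  induction hw i g l with
  | gen a =>
    exact .of_eq (a := ⟨a, hi, hl⟩) rfl
  | @mul i j l m _ _ x hx _ _ ihl ihr =>
    obtain ⟨hl', hj⟩ := hcore l j (hx ▸ WithZero.coe_ne_zero)
    have hx' : matrixBlock P Λ'ᶜ I'ᶜ ⟨l, hl'⟩ ⟨j, hj⟩ = x := hx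
    exact .mul hx' (ihl hi hl') (ihr hj hl)

theorem IsGeneratingFamily.extend {w : α → ↥I'ᶜ × G × ↥Λ'ᶜ}
    (hw : IsGeneratingFamily (matrixBlock P Λ'ᶜ I'ᶜ) w) {m : Λ} {j : I} (hm : m ∉ Λ') (hj : j ∉ I')
    (hmj : P m j ≠ 0) :
    IsGeneratingFamily P (Sum.elim
      (Sum.elim (fun a => ((w a).1.1, (w a).2.1, (w a).2.2.1)) fun i : I' => (i.1, 1, m))
      fun l : Λ' => (j, 1, l.1)) := by
  set w' := Sum.elim
    (Sum.elim (fun a => ((w a).1.1, (w a).2.1, (w a).2.2.1)) fun i : I' => (i.1, (1 : G), m))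
    fun l : Λ' => (j, (1 : G), l.1)
  obtain ⟨p, hp⟩ := WithZero.ne_zero_iff_exists.1 hmj
  have hcore {i g l} (h : IsProduct (matrixBlock P Λ'ᶜ I'ᶜ) w i g l) :
      IsProduct P w' i.1 g l.1 := by
    induction h with
    | gen a => exact .of_eq (a := .inl (.inl a)) rfl
    | mul hx _ _ ihl ihr => exact .mul hx ihl ihr
  have hrow (i : I) (g : G) {l : Λ} (hl : l ∉ Λ') : IsProduct P w' i g l := by
    by_cases hi : i ∈ I'
    · have hgen : IsProduct P w' i 1 m := .of_eq (a := .inl (.inr ⟨i, hi⟩)) rfl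
      simpa using hgen.mul hp.symm (hcore (hw ⟨j, hj⟩ (p⁻¹ * g) ⟨l, hl⟩))
    · exact hcore (hw ⟨i, hi⟩ g ⟨l, hl⟩)
  intro i g l
  by_cases hl : l ∈ Λ'
  · have hgen : IsProduct P w' j 1 l := .of_eq (a := .inr ⟨l, hl⟩) rfl
    simpa using (hrow i (g * p⁻¹) hm).mul hp.symm hgen
  · exact hrow i g hl

theorem rankWithZero_eq_add_ncard [Finite G] [Finite I] [Finite Λ]
    (hcore : ∀ l i, P l i ≠ 0 → l ∉ Λ' ∧ i ∉ I') (hP : P ≠ 0) :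
    rankWithZero (ReesMatrixSemigroup P) =
      rankWithZero (ReesMatrixSemigroup (matrixBlock P Λ'ᶜ I'ᶜ)) + I'.ncard + Λ'.ncard := by
  obtain ⟨m, j, hmj⟩ : ∃ m j, P m j ≠ 0 := by
    contrapose! hP
    exact Matrix.ext hP
  obtain ⟨hm, hj⟩ := hcore m j hmj
  apply le_antisymm
  · obtain ⟨T, hT, hle⟩ := exists_isGeneratingFamily (matrixBlock P Λ'ᶜ I'ᶜ)
    refine (rankWithZero_le (hT.extend hm hj hmj)).trans ?_
    simp only [Nat.card_sum, Nat.card_coe_set_eq]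
    gcongr
  · obtain ⟨T, hT, hle⟩ := exists_isGeneratingFamily P
    refine le_trans ?_ ((hT.card_core_add_le hcore hmj).trans hle)
    gcongr
    exact rankWithZero_le (hT.restrict hcore)

end ZeroBlock

section RegularMatrix

open Sum

variable {G I Λ α κ : Type*} [Group G] {P : Matrix Λ I (WithZero G)} {w : α → I × G × Λ}

/-- The non-zero entries of `P` as labelled arrows: `P l i = p` is an arrow `l → i` with label `p`.
Their underlying undirected graph is the Graham–Houghton graph. -/
inductive EntryArrow (P : Matrix Λ I (WithZero G)) : I ⊕ Λ → G → I ⊕ Λ → Prop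
  | intro {l : Λ} {i : I} {p : G} (h : P l i = p) : EntryArrow P (inr l) p (inl i)

/-- The arrows `EntryArrow P` together with an arrow `i → l` with label `g` for each member
`(i, g, l)` of `w`. Walks from `I` to `Λ` alternate between the two kinds of arrows and spell out
the non-zero products of members of `w`. -/
inductive GeneratorArrow (P : Matrix Λ I (WithZero G)) (w : α → I × G × Λ) :
    I ⊕ Λ → G → I ⊕ Λ → Prop
  | gen (a : α) : GeneratorArrow P w (inl (w a).1) (w a).2.1 (inr (w a).2.2)
  | entry {u v : I ⊕ Λ} {p : G} (h : EntryArrow P u p v) : GeneratorArrow P w u p v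

theorem isProduct_iff_labelledWalk {i : I} {g : G} {l : Λ} :
    IsProduct P w i g l ↔ LabelledWalk (GeneratorArrow P w) (inl i) g (inr l) := by
  constructor
  · intro h
    induction h with
    | gen a => exact .single (.gen a)
    | mul hx _ _ ihl ihr => exact (ihl.tail (.entry (.intro hx))).trans ihr
  · -- A walk that ends in `I` turns every product starting there into a product starting at `i`.
    suffices ∀ {g v}, LabelledWalk (GeneratorArrow P w) (inl i) g v →
        v.elim (fun j => ∀ h m, IsProduct P w j h m → IsProduct P w i (g * h) m)
          (fun l => IsProduct P w i g l) from this
    intro g v p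
    induction p with
    | refl => simp
    | tail _ e ih =>
      rcases e with a | e
      · exact ih _ _ (.gen a)
      · obtain ⟨hx⟩ := e
        exact fun _ _ h => IsProduct.mul hx ih h

/-- The regular matrix `P` is block diagonal with blocks indexed by `κ`, where `b` tells the block
of each column and row, and each block is connected by its entries equal to `1`. -/
structure IsBlockLabelling (P : Matrix Λ I (WithZero G)) (b : I ⊕ Λ → κ) : Prop where
  regular : IsRegularMatrix P
  surjective : Function.Surjective b
  eq_of_ne_zero : ∀ {l i}, P l i ≠ 0 → b (inr l) = b (inl i)
  eqvGen_one : ∀ {u v}, b u = b v → Relation.EqvGen (fun u v => EntryArrow P u 1 v) u v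

/-- The subgroup generated by the non-zero entries in block `k` of `P`. -/
def blockSubgroup (P : Matrix Λ I (WithZero G)) (b : I ⊕ Λ → κ) (k : κ) : Subgroup G :=
  Subgroup.closure {g | ∃ l i, b (inl i) = k ∧ P l i = (g : WithZero G)}

/-- The group component of the member `w a` after switching by the potential `θ ∘ b`. -/
def switchedLabel (θ : κ → G) (b : I ⊕ Λ → κ) (w : α → I × G × Λ) (a : α) : G :=
  θ (b (inl (w a).1)) * (w a).2.1 * (θ (b (inr (w a).2.2)))⁻¹

namespace IsBlockLabelling

variable {b : I ⊕ Λ → κ}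

theorem eq_of_entryArrow (hb : IsBlockLabelling P b) {u v : I ⊕ Λ} {p : G}
    (e : EntryArrow P u p v) : b u = b v := by
  obtain ⟨hp⟩ := e
  exact hb.eq_of_ne_zero (hp ▸ WithZero.coe_ne_zero)

theorem exists_col (hb : IsBlockLabelling P b) (k : κ) : ∃ i, b (inl i) = k := by
  obtain ⟨i | l, hk⟩ := hb.surjective k
  · exact ⟨i, hk⟩
  · obtain ⟨i, hi⟩ := hb.regular.1 l
    exact ⟨i, (hb.eq_of_ne_zero hi).symm.trans hk⟩

theorem exists_row (hb : IsBlockLabelling P b) (k : κ) : ∃ l, b (inr l) = k := by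
  obtain ⟨i, hi⟩ := hb.exists_col k
  obtain ⟨l, hl⟩ := hb.regular.2 i
  exact ⟨l, (hb.eq_of_ne_zero hl).trans hi⟩

theorem closure_arrowLabels_switch (hb : IsBlockLabelling P b) (θ : κ → G) (w : α → I × G × Λ) :
    Subgroup.closure (arrowLabels (switch (θ ∘ b) (GeneratorArrow P w))) =
      Subgroup.closure (conjUnion θ (blockSubgroup P b) ∪ Set.range (switchedLabel θ b w)) := by
  rw [arrowLabels_switch]
  apply le_antisymm <;> rw [Subgroup.closure_le]
  · rintro _ ⟨_, p, _, a | e, rfl⟩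
    · exact Subgroup.subset_closure (.inr ⟨a, rfl⟩)
    · have hlab := hb.eq_of_entryArrow e
      obtain @⟨l, i, _, hp⟩ := e
      refine Subgroup.subset_closure (.inl (Set.mem_iUnion.2 ⟨b (inl i), p, ?_, ?_⟩))
      · exact Subgroup.subset_closure ⟨l, i, rfl, hp⟩
      · simp only [Function.comp_apply, hlab]
  · rintro z (hz | ⟨a, rfl⟩)
    · obtain ⟨k, h, hh, rfl⟩ := Set.mem_iUnion.1 hz
      suffices hle : blockSubgroup P b k ≤ Subgroup.comap (MulAut.conj (θ k)).toMonoidHom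
          (Subgroup.closure _) from hle hh
      rw [blockSubgroup, Subgroup.closure_le]
      rintro p ⟨l, i, rfl, hp⟩
      refine Subgroup.subset_closure ⟨inr l, p, inl i, .entry (.intro hp), ?_⟩
      simp [hb.eq_of_entryArrow (.intro hp)]
    · exact Subgroup.subset_closure ⟨_, _, _, .gen a, rfl⟩

theorem closure_eq_top (hb : IsBlockLabelling P b) [Nonempty κ] (hw : IsGeneratingFamily P w)
    (θ : κ → G) :
    Subgroup.closure (conjUnion θ (blockSubgroup P b) ∪ Set.range (switchedLabel θ b w)) = ⊤ := by
  obtain ⟨i, -⟩ := hb.exists_col (Classical.arbitrary κ)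
  obtain ⟨l, -⟩ := hb.exists_row (Classical.arbitrary κ)
  rw [← hb.closure_arrowLabels_switch, eq_top_iff]
  intro g _
  exact ((LabelledWalk.switch_iff _).2 (isProduct_iff_labelledWalk.1 (hw i _ l))).mem_closure

theorem eqvGen_switch_one (hb : IsBlockLabelling P b) {θ : κ → G} {T : Set α}
    (hT : IsOutTree (fun a => b (inl (w a).1)) (fun a => b (inr (w a).2.2)) T Set.univ)
    (hone : ∀ a ∈ T, switchedLabel θ b w a = 1) (u v : I ⊕ Λ) :
    Relation.EqvGen (fun u v => switch (θ ∘ b) (GeneratorArrow P w) u 1 v) u v := by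
  set E := switch (θ ∘ b) (GeneratorArrow P w)
  have within_block {u v : I ⊕ Λ} (huv : b u = b v) : Relation.EqvGen (fun u v => E u 1 v) u v :=
    (hb.eqvGen_one huv).mono fun u v e => by
      simpa [hb.eq_of_entryArrow e] using switch_of_arrow (θ ∘ b) (GeneratorArrow.entry (w := w) e)
  suffices ∀ {k k'},
      Relation.EqvGen (fun k k' => ∃ a ∈ T, b (inl (w a).1) = k ∧ b (inr (w a).2.2) = k') k k' →
      ∀ u v, b u = k → b v = k' → Relation.EqvGen (fun u v => E u 1 v) u v from
    this (hT.eqvGen trivial trivial) u v rfl rfl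
  intro k k' h
  induction h with
  | rel k k' h =>
    obtain ⟨a, ha, rfl, rfl⟩ := h
    have e : E (inl (w a).1) 1 (inr (w a).2.2) := hone a ha ▸ switch_of_arrow (θ ∘ b) (.gen a)
    exact fun u v hu hv => ((within_block hu).trans _ _ _ (.rel _ _ e)).trans _ _ _
      (within_block hv.symm)
  | refl k => exact fun u v hu hv => within_block (hu.trans hv.symm)
  | symm k k' _ ih => exact fun u v hu hv => (ih v u hv hu).symm
  | trans k k' k'' _ _ ih ih' =>
    intro u v hu hv
    obtain ⟨x, hx⟩ := hb.surjective k'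
    exact (ih u x hu hx).trans _ _ _ (ih' x v hx hv)

theorem isGeneratingFamily [Finite G] (hb : IsBlockLabelling P b) {θ : κ → G} {T : Set α}
    (hconn : ∀ u v, ∃ g, LabelledWalk (GeneratorArrow P w) u g v)
    (hT : IsOutTree (fun a => b (inl (w a).1)) (fun a => b (inr (w a).2.2)) T Set.univ)
    (hone : ∀ a ∈ T, switchedLabel θ b w a = 1)
    (htop : Subgroup.closure
      (conjUnion θ (blockSubgroup P b) ∪ Set.range (switchedLabel θ b w)) = ⊤) :
    IsGeneratingFamily P w := by
  have hconn' (u v : I ⊕ Λ) :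
      ∃ g, LabelledWalk (switch (θ ∘ b) (GeneratorArrow P w)) u g v := by
    obtain ⟨g, p⟩ := hconn u v
    exact ⟨θ (b u) * g * (θ (b v))⁻¹, (LabelledWalk.switch_iff _).2 (by simpa [mul_assoc])⟩
  intro i g l
  rw [isProduct_iff_labelledWalk]
  have p := LabelledWalk.of_mem_closure (z := θ (b (inl i)) * g * (θ (b (inr l)))⁻¹) hconn'
    (hb.eqvGen_switch_one hT hone) (hb.closure_arrowLabels_switch θ w ▸ htop ▸ Subgroup.mem_top _)
    (inl i) (inr l)
  simpa [mul_assoc] using (LabelledWalk.switch_iff _).1 p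

end IsBlockLabelling

end RegularMatrix

section RankRegular

open Sum

variable {G I Λ α κ : Type*} [Group G] {P : Matrix Λ I (WithZero G)} {w : α → I × G × Λ}

namespace IsBlockLabelling

variable {b : I ⊕ Λ → κ}

theorem exists_isOutTree [Finite κ] [Nonempty κ] (hb : IsBlockLabelling P b)
    (hconn : ∀ i l, ∃ g, LabelledWalk (GeneratorArrow P w) (inl i) g (inr l)) :
    ∃ T, IsOutTree (fun a => b (inl (w a).1)) (fun a => b (inr (w a).2.2)) T Set.univ := by
  refine exists_isOutTree_univ fun V hV hVuniv => ?_
  obtain ⟨k, hk⟩ := hV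
  obtain ⟨k', hk'⟩ := (Set.ne_univ_iff_exists_notMem V).1 hVuniv
  obtain ⟨i, rfl⟩ := hb.exists_col k
  obtain ⟨l, rfl⟩ := hb.exists_row k'
  obtain ⟨g, p⟩ := hconn i l
  obtain ⟨u, x, v, e, hu, hv⟩ := p.exists_arrow_leaving (W := b ⁻¹' V) hk hk'
  rcases e with a | e
  · exact ⟨a, hu, hv⟩
  · rw [Set.mem_preimage, ← hb.eq_of_entryArrow e] at hv
    exact (hv hu).elim

theorem sigmaMin_add_le_card [Finite G] [Finite α] {n : ℕ} [NeZero n] {b : I ⊕ Λ → Fin n}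
    (hb : IsBlockLabelling P b) (hw : IsGeneratingFamily P w) :
    sigmaMin (blockSubgroup P b) + n - 1 ≤ Nat.card α := by
  obtain ⟨T, hT⟩ := hb.exists_isOutTree fun i l => ⟨1, isProduct_iff_labelledWalk.1 (hw i 1 l)⟩
  obtain ⟨θ, hθ⟩ := hT.exists_potential fun a => (w a).2.1
  have htop : Subgroup.closure
      (conjUnion θ (blockSubgroup P b) ∪ switchedLabel θ b w '' Tᶜ) = ⊤ := by
    rw [eq_top_iff, ← hb.closure_eq_top hw θ, Subgroup.closure_le]
    rintro g (hg | ⟨a, rfl⟩)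
    · exact Subgroup.subset_closure (.inl hg)
    by_cases ha : a ∈ T
    · have hone : switchedLabel θ b w a = 1 := hθ a ha
      exact hone ▸ one_mem _
    · exact Subgroup.subset_closure (.inr ⟨a, ha, rfl⟩)
  have hle : sigmaMin (blockSubgroup P b) ≤ Tᶜ.ncard :=
    (sigmaMin_le_ncard htop).trans Set.ncard_image_le
  have htree : T.ncard + 1 = n := by simpa using hT.ncard_add_one
  have hcompl := Set.ncard_add_ncard_compl T
  lia

end IsBlockLabelling

theorem exists_labelledWalk (hP : ∀ l, ∃ i, P l i ≠ 0)
    (hcol : ∀ i, ∃ a, (w a).1 = i) (hrow : ∀ l, ∃ a, (w a).2.2 = l)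
    (hw : ∀ a a', Relation.TransGen (fun x y => P (w x).2.2 (w y).1 ≠ 0) a a') (u v : I ⊕ Λ) :
    ∃ g, LabelledWalk (GeneratorArrow P w) u g v := by
  have entry {l : Λ} {i : I} (hli : P l i ≠ 0) :
      ∃ g, LabelledWalk (GeneratorArrow P w) (inr l) g (inl i) := by
    obtain ⟨p, hp⟩ := WithZero.ne_zero_iff_exists.1 hli
    exact ⟨p, .single (.entry (.intro hp.symm))⟩
  have between (a a' : α) :
      ∃ g, LabelledWalk (GeneratorArrow P w) (inl (w a).1) g (inl (w a').1) := by
    induction hw a a' with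
    | single h => exact (entry h).imp' _ fun _ p => (LabelledWalk.single (.gen a)).trans p
    | @tail x y _ h ih =>
      obtain ⟨g, p⟩ := ih
      exact (entry h).imp' _ fun _ q => (p.tail (.gen x)).trans q
  have to_vertex (a : α) : ∃ g, LabelledWalk (GeneratorArrow P w) (inl (w a).1) g v := by
    rcases v with i | l
    · obtain ⟨a', rfl⟩ := hcol i
      exact between a a'
    · obtain ⟨a', rfl⟩ := hrow l
      exact (between a a').imp' _ fun _ p => p.tail (.gen a')
  rcases u with i | l
  · obtain ⟨a, rfl⟩ := hcol i
    exact to_vertex a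
  · obtain ⟨i, hli⟩ := hP l
    obtain ⟨a, rfl⟩ := hcol i
    obtain ⟨g, p⟩ := entry hli
    exact (to_vertex a).imp' _ fun _ q => p.trans q

namespace IsBlockLabelling

variable {n : ℕ} [NeZero n] {b : I ⊕ Λ → Fin n}

theorem exists_generatingFamily [Finite G] [Finite I] [Finite Λ] [Finite α]
    (hb : IsBlockLabelling P b) (hI : Nat.card I ≤ Nat.card α) (hΛ : Nat.card Λ ≤ Nat.card α)
    (hσ : sigmaMin (blockSubgroup P b) + n - 1 ≤ Nat.card α) :
    ∃ w : α → I × G × Λ, IsGeneratingFamily P w := by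
  have : Nonempty I := ⟨(hb.exists_col 0).choose⟩
  have : Nonempty Λ := ⟨(hb.exists_row 0).choose⟩
  obtain ⟨d, c, hd, hc, hcd⟩ := exists_surjective_transGen hb.regular.1 hb.regular.2 hΛ hI
  have hconn (x : α → G) :=
    exists_labelledWalk (w := fun a => (c a, x a, d a)) hb.regular.1 hc hd hcd
  obtain ⟨T, hT⟩ := hb.exists_isOutTree fun i l => hconn 1 (inl i) (inr l)
  obtain ⟨θ, X, hX, htop⟩ := exists_ncard_eq_sigmaMin (blockSubgroup P b)
  have htree : T.ncard + 1 = n := by simpa using hT.ncard_add_one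
  have hcompl := Set.ncard_add_ncard_compl T
  obtain ⟨y, hyT, hyX⟩ := exists_eqOn_and_subset_range X.toFinite (show X.ncard ≤ Tᶜ.ncard by lia) 1
  let w (a : α) : I × G × Λ := (c a, (θ (b (inl (c a))))⁻¹ * y a * θ (b (inr (d a))), d a)
  have hwy : switchedLabel θ b w = y := funext fun a => by simp [switchedLabel, w, mul_assoc]
  refine ⟨w, hb.isGeneratingFamily (θ := θ) (hconn _) hT (hwy ▸ hyT) ?_⟩
  rw [hwy, eq_top_iff, ← htop]
  exact Subgroup.closure_mono (Set.union_subset_union_right _ hyX)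

theorem rankWithZero_eq [Finite G] [Finite I] [Finite Λ] (hb : IsBlockLabelling P b) :
    rankWithZero (ReesMatrixSemigroup P) =
      max (max (Nat.card I) (Nat.card Λ)) (sigmaMin (blockSubgroup P b) + n - 1) := by
  apply le_antisymm
  · set r := max (max (Nat.card I) (Nat.card Λ)) (sigmaMin (blockSubgroup P b) + n - 1) with hr
    obtain ⟨w, hw⟩ : ∃ w : Fin r → I × G × Λ, IsGeneratingFamily P w := by
      apply hb.exists_generatingFamily <;> simp [hr]
    simpa using rankWithZero_le hw
  · obtain ⟨T, hT, hle⟩ := exists_isGeneratingFamily P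
    obtain ⟨i, -⟩ := hb.exists_col 0
    obtain ⟨l, hli⟩ := hb.regular.2 i
    rw [← Nat.card_coe_set_eq] at hle
    refine (max_le (max_le ?_ ?_) (hb.sigmaMin_add_le_card hT)).trans hle
    · exact Nat.card_le_card_of_surjective (fun t : T => t.1.1)
        fun j => (hT.exists_col_eq hli j).imp fun _ h => h.1
    · exact Nat.card_le_card_of_surjective (fun t : T => t.1.2.2)
        fun m => (hT.exists_row_eq hli m).imp fun _ h => h.1

end IsBlockLabelling

end RankRegular

end ReesMatrixSemigroup

section GrahamNormalForm

open Sum Relation ReesMatrixSemigroup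

namespace IsGrahamNormalForm

variable {G I Λ : Type*} [Group G] {P : Matrix Λ I (WithZero G)} {I' : Set I} {Λ' : Set Λ} {n : ℕ}
  {Ib : Fin n → Set I} {Λb : Fin n → Set Λ}

theorem exists_block (hP : IsGrahamNormalForm P I' Λ' Ib Λb) {l : Λ} {i : I} (h : P l i ≠ 0) :
    ∃ k, l ∈ Λb k ∧ i ∈ Ib k :=
  not_imp_comm.1 (hP.zero_off_blocks l i) h

theorem mem_core (hP : IsGrahamNormalForm P I' Λ' Ib Λb) {l : Λ} {i : I} (h : P l i ≠ 0) :
    l ∈ Λ'ᶜ ∧ i ∈ I'ᶜ := by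
  obtain ⟨k, hl, hi⟩ := hP.exists_block h
  exact ⟨hP.iUnion_rows ▸ Set.mem_iUnion_of_mem k hl, hP.iUnion_cols ▸ Set.mem_iUnion_of_mem k hi⟩

theorem eqvGen_one_of_reachable (hP : IsGrahamNormalForm P I' Λ' Ib Λb) {u v : ↥I'ᶜ ⊕ ↥Λ'ᶜ}
    (h : (grahamHoughtonGraph P).Reachable (u.map Subtype.val Subtype.val)
      (v.map Subtype.val Subtype.val)) :
    EqvGen (fun u v => EntryArrow (matrixBlock P Λ'ᶜ I'ᶜ) u 1 v) u v := by
  obtain ⟨F, ⟨hle, -, hF⟩, hone⟩ := hP.normalized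
  have hwalk := (SimpleGraph.reachable_iff_reflTransGen _ _).1 (hF _ _ h)
  clear h
  generalize hx : u.map Subtype.val Subtype.val = x at hwalk
  induction hwalk using ReflTransGen.head_induction_on generalizing u with
  | refl =>
    rw [Sum.map_injective.2 ⟨Subtype.val_injective, Subtype.val_injective⟩ hx]
    exact .refl _
  | @head _ y hxy _ ih =>
    subst hx
    rcases u with i | l <;> rcases y with j | m
    · exact (hle hxy).elim
    · let m' : ↥Λ'ᶜ := ⟨m, (hP.mem_core (hle hxy)).1⟩
      have e : EntryArrow (matrixBlock P Λ'ᶜ I'ᶜ) (inr m') 1 (inl i) := .intro (hone _ _ hxy)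
      exact (EqvGen.rel _ _ e).symm.trans _ _ _ (ih (u := inr m') rfl)
    · let j' : ↥I'ᶜ := ⟨j, (hP.mem_core (hle hxy)).2⟩
      have e : EntryArrow (matrixBlock P Λ'ᶜ I'ᶜ) (inr l) 1 (inl j') := .intro (hone _ _ hxy.symm)
      exact (EqvGen.rel _ _ e).trans _ _ _ (ih (u := inl j') rfl)
    · exact (hle hxy).elim

theorem reachable_of_mem_block (hP : IsGrahamNormalForm P I' Λ' Ib Λb) {k : Fin n}
    {u v : ↥(Ib k) ⊕ ↥(Λb k)} :
    (grahamHoughtonGraph P).Reachable (u.map Subtype.val Subtype.val)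
      (v.map Subtype.val Subtype.val) :=
  ((hP.connected_block k).preconnected u v).map
    ⟨Sum.map Subtype.val Subtype.val, by
      rintro (i | l) (j | m) h <;> exact h⟩

theorem neZero (hP : IsGrahamNormalForm P I' Λ' Ib Λb) (hne : P ≠ 0) : NeZero n := by
  obtain ⟨l, i, h⟩ : ∃ l i, P l i ≠ 0 := by
    by_contra! h
    exact hne (Matrix.ext h)
  obtain ⟨k, -⟩ := hP.exists_block h
  exact ⟨k.pos.ne'⟩

variable {c : ↥I'ᶜ → Fin n} {d : ↥Λ'ᶜ → Fin n}

theorem row_eq_col (hP : IsGrahamNormalForm P I' Λ' Ib Λb) (hc : ∀ i k, ↑i ∈ Ib k ↔ c i = k)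
    (hd : ∀ l k, ↑l ∈ Λb k ↔ d l = k) {l : ↥Λ'ᶜ} {i : ↥I'ᶜ} (h : P l i ≠ 0) : d l = c i := by
  obtain ⟨k, hl, hi⟩ := hP.exists_block h
  rw [(hd l k).1 hl, (hc i k).1 hi]

theorem isBlockLabelling (hP : IsGrahamNormalForm P I' Λ' Ib Λb)
    (hc : ∀ i k, ↑i ∈ Ib k ↔ c i = k) (hd : ∀ l k, ↑l ∈ Λb k ↔ d l = k) :
    IsBlockLabelling (matrixBlock P Λ'ᶜ I'ᶜ) (Sum.elim c d) := by
  have exists_mem_block {u k} (h : Sum.elim c d u = k) : ∃ u' : ↥(Ib k) ⊕ ↥(Λb k),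
      u'.map Subtype.val Subtype.val = u.map Subtype.val Subtype.val := by
    rcases u with i | l
    · exact ⟨inl ⟨i, (hc i k).2 h⟩, rfl⟩
    · exact ⟨inr ⟨l, (hd l k).2 h⟩, rfl⟩
  refine ⟨⟨fun l => ?_, fun i => ?_⟩, fun k => ?_, hP.row_eq_col hc hd, fun h => ?_⟩
  · obtain ⟨i, h⟩ := (hP.regular_block (d l)).1 ⟨l, (hd l _).2 rfl⟩
    exact ⟨⟨i, (hP.mem_core h).2⟩, h⟩
  · obtain ⟨l, h⟩ := (hP.regular_block (c i)).2 ⟨i, (hc i _).2 rfl⟩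
    exact ⟨⟨l, (hP.mem_core h).1⟩, h⟩
  · obtain ⟨i | l⟩ := (hP.connected_block k).nonempty
    · have hi : ↑i ∈ I'ᶜ := hP.iUnion_cols ▸ Set.mem_iUnion_of_mem k i.2
      exact ⟨inl ⟨i, hi⟩, (hc _ k).1 i.2⟩
    · have hl : ↑l ∈ Λ'ᶜ := hP.iUnion_rows ▸ Set.mem_iUnion_of_mem k l.2
      exact ⟨inr ⟨l, hl⟩, (hd _ k).1 l.2⟩
  · obtain ⟨u', hu⟩ := exists_mem_block h
    obtain ⟨v', hv⟩ := exists_mem_block rfl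
    exact hP.eqvGen_one_of_reachable (hu ▸ hv ▸ hP.reachable_of_mem_block)

theorem blockSubgroup_eq (hP : IsGrahamNormalForm P I' Λ' Ib Λb)
    (hc : ∀ i k, ↑i ∈ Ib k ↔ c i = k) (hd : ∀ l k, ↑l ∈ Λb k ↔ d l = k) (k : Fin n) :
    blockSubgroup (matrixBlock P Λ'ᶜ I'ᶜ) (Sum.elim c d) k =
      entrySubgroup (matrixBlock P (Λb k) (Ib k)) := by
  refine congrArg Subgroup.closure (Set.ext fun g => ⟨?_, ?_⟩)
  · rintro ⟨l, i, hi, h⟩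
    have hl : d l = k := (hP.row_eq_col hc hd (h.trans_ne WithZero.coe_ne_zero)).trans hi
    exact ⟨⟨l, (hd l k).2 hl⟩, ⟨i, (hc i k).2 hi⟩, h⟩
  · rintro ⟨l, i, h⟩
    have hcore := hP.mem_core (h.trans_ne WithZero.coe_ne_zero)
    exact ⟨⟨l, hcore.1⟩, ⟨i, hcore.2⟩, (hc _ k).1 i.2, h⟩

end IsGrahamNormalForm

end GrahamNormalForm

theorem theorem2p5 {G I Λ : Type*} [Group G] [Finite G] [Finite I] [Finite Λ]
    (P : Matrix Λ I (WithZero G)) (I' : Set I) (Λ' : Set Λ)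
    {n : ℕ} (Ib : Fin n → Set I) (Λb : Fin n → Set Λ)
    (hP : IsGrahamNormalForm P I' Λ' Ib Λb) :
    (P = 0 → rankWithZero (ReesMatrixSemigroup P) = Nat.card G * Nat.card I * Nat.card Λ) ∧
    (P ≠ 0 → rankWithZero (ReesMatrixSemigroup P) =
      max (max I'ᶜ.ncard Λ'ᶜ.ncard)
        (sigmaMin (fun k => entrySubgroup (matrixBlock P (Λb k) (Ib k))) + n - 1)
        + I'.ncard + Λ'.ncard) := by
  refine ⟨ReesMatrixSemigroup.rankWithZero_of_eq_zero, fun hne => ?_⟩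
  have : NeZero n := hP.neZero hne
  obtain ⟨c, hc⟩ := exists_forall_mem_iff_eq hP.disjoint_cols hP.iUnion_cols
  obtain ⟨d, hd⟩ := exists_forall_mem_iff_eq hP.disjoint_rows hP.iUnion_rows
  rw [ReesMatrixSemigroup.rankWithZero_eq_add_ncard (fun _ _ => hP.mem_core) hne,
    (hP.isBlockLabelling hc hd).rankWithZero_eq, funext (hP.blockSubgroup_eq hc hd),
    Nat.card_coe_set_eq, Nat.card_coe_set_eq]
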